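/- Fix a dimension $d\ge 1$, a Lipschitz constant $C_{\mathrm{Lip}}>0$ and a constant $c_Q\in(0,1]$. Write $\mathcal X=[0,1]^d$ and $\mathcal P=[0,1]$; all norms and balls are with respect to $\ell_\infty$. A (target-only) contextual dynamic pricing problem $I$ consists of a probability distribution $Q_X$ on $\mathcal X$, a reward function $f:\mathcal X\times\mathcal P\to[0,1]$, and a conditional law of the revenue $Y\in[0,1]$ given the covariate and the price with $\mathbb E\{Y\mid X=x,p\}=f(x,p)$ for all $(x,p)$. In round $t=1,\dots,n_Q$ a covariate $X_t\sim Q_X$ is drawn independently of the past; the seller sets a price $p_t\in\mathcal P$, possibly at random, according to a distribution depending measurably on $(X_s,p_s,Y_s)_{s<t}$ and $X_t$ (such a rule is a policy $\pi$); then the revenue $Y_t$ is drawn from the conditional law at $(X_t,p_t)$. The cumulative regret is $$R_{\pi,I}(n_Q)=\sum_{t=1}^{n_Q}\mathbb E\{f^*(X_t)-f(X_t,p_t)\},\qquad f^*(x)=\max_{p\in\mathcal P}f(x,p).$$ For $C_Q\ge 2^d$ let $\mathcal I(C_{\mathrm{Lip}},c_Q,C_Q)$ be the class of all such problems for which $f$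 is Lipschitz with constant $C_{\mathrm{Lip}}$ with respect to $\ell_\infty$, and $$c_Q r^d\le Q_X(B_{\mathcal X}(x,r))\le C_Q r^d\qquad\text{for all } x\in\mathrm{supp}(Q_X),\ r\in(0,1].$$ Then there is a constant $c>0$, depending only on $C_{\mathrm{Lip}}$, $c_Q$ and $d$ (in particular not on $C_Q$ or $n_Q$), such that for every $C_Q\ge 2^d$ and every integer $n_Q\ge 1$, $$\inf_{\pi}\ \sup_{I\in\mathcal I(C_{\mathrm{Lip}},c_Q,C_Q)}R_{\pi,I}(n_Q)\ \ge\ c\, n_Q^{\frac{d+2}{d+3}}.$$ -/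

import Mathlib

open MeasureTheory ProbabilityTheory

noncomputable section

namespace DynamicPricing

/-- The covariate space `[0,1]^d`. Its metric is the sup (`ℓ∞`) metric. -/
abbrev Covariate (d : ℕ) : Type := Fin d → unitInterval

/-- The price space `[0,1]`. The product `Covariate d × Price` carries the `ℓ∞` metric
of `[0,1]^(d+1)`. -/
abbrev Price : Type := unitInterval

/-- Revenues take values in `[0,1]`. -/
abbrev Revenue : Type := unitInterval

/-- What is recorded in one round: covariate, price, revenue. -/
abbrev Obs (d : ℕ) : Type := Covariate d × Price × Revenue

/-- A target-only contextual dynamic pricing problem: the covariate distribution, the reward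
function `f`, and the conditional law of the revenue given covariate and price, which has
conditional expectation `f`. -/
structure Problem (d : ℕ) where
  /-- the target covariate distribution -/
  covLaw : Measure (Covariate d)
  isProb : IsProbabilityMeasure covLaw
  /-- the reward function -/
  f : Covariate d × Price → unitInterval
  /-- the conditional law of the revenue given covariate and price -/
  revLaw : Kernel (Covariate d × Price) Revenue
  isMarkov : IsMarkovKernel revLaw
  mean_revLaw : ∀ z, ∫ y, (y : ℝ) ∂(revLaw z) = (f z : ℝ)

attribute [instance] Problem.isProb Problem.isMarkov

/-- A price policy: in round `t` (rounds are numbered from `0`) the price is drawn from a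
distribution that depends measurably on the `t` earlier observations and on the current
covariate. Nonrandomized policies, where the price is a measurable function of these, are the
case of Dirac kernels. -/
structure Policy (d : ℕ) where
  price : (t : ℕ) → Kernel ((Fin t → Obs d) × Covariate d) Price
  isMarkov : ∀ t, IsMarkovKernel (price t)

attribute [instance] Policy.isMarkov

variable {d : ℕ}

/-- The conditional law of the observation `(X, p, Y)` of round `t` given the past: `X` is a
fresh draw from the covariate distribution, `p` is drawn by the policy, and `Y` is drawn from
the revenue law at `(X, p)`. -/
def stepKernel (π : Policy d) (I : Problem d) (t : ℕ) : Kernel (Fin t → Obs d) (Obs d) :=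
  (Kernel.const (Fin t → Obs d) I.covLaw) ⊗ₖ
    (π.price t ⊗ₖ
      (I.revLaw.comap
        (fun w : ((Fin t → Obs d) × Covariate d) × Price => (w.1.2, w.2)) (by fun_prop)))

instance (π : Policy d) (I : Problem d) (t : ℕ) : IsMarkovKernel (stepKernel π I t) := by
  unfold stepKernel
  infer_instance

/-- The joint law of the first `n` observations when policy `π` is used on problem `I`. -/
def law (π : Policy d) (I : Problem d) : (n : ℕ) → Measure (Fin n → Obs d)
  | 0 => Measure.dirac Fin.elim0
  | n + 1 => (law π I n ⊗ₘ stepKernel π I n).map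
      (fun w => Fin.snoc (α := fun _ => Obs d) w.1 w.2)

theorem measurable_snoc (n : ℕ) :
    Measurable (fun w : (Fin n → Obs d) × Obs d =>
      (Fin.snoc (α := fun _ => Obs d) w.1 w.2 : Fin (n + 1) → Obs d)) := by
  refine measurable_pi_lambda _ fun i => ?_
  refine Fin.lastCases ?_ (fun j => ?_) i
  · simpa using measurable_snd
  · simp only [Fin.snoc_castSucc]
    exact (measurable_pi_apply j).comp measurable_fst

instance isProbabilityMeasure_law (π : Policy d) (I : Problem d) (n : ℕ) :
    IsProbabilityMeasure (law π I n) := by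
  induction n with
  | zero => unfold law; infer_instance
  | succ n ih =>
    unfold law
    exact Measure.isProbabilityMeasure_map (measurable_snoc n).aemeasurable

/-- `f*(x) = max_p f(x, p)`, the maximal expected revenue at covariate `x`. -/
def Problem.fStar (I : Problem d) (x : Covariate d) : ℝ :=
  ⨆ p : Price, (I.f (x, p) : ℝ)

/-- The cumulative regret `∑_{t ≤ n} E[f*(X_t) - f(X_t, p_t)]`. -/
def regret (π : Policy d) (I : Problem d) (n : ℕ) : ℝ :=
  ∑ t : Fin n, ∫ h, (I.fStar (h t).1 - (I.f ((h t).1, (h t).2.1) : ℝ)) ∂(law π I n)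

/-- The reward function is Lipschitz with constant `C` for the `ℓ∞` norm. -/
def LipschitzReward (C : ℝ) (I : Problem d) : Prop :=
  ∀ z z' : Covariate d × Price, |(I.f z : ℝ) - (I.f z' : ℝ)| ≤ C * dist z z'

/-- The two-sided ball-mass condition `c r^d ≤ Q(B(x, r)) ≤ C r^d` for all `x` in the support
of the covariate distribution and all `0 < r ≤ 1`. -/
def BallMass (c C : ℝ) (I : Problem d) : Prop :=
  ∀ x ∈ I.covLaw.support, ∀ r : ℝ, 0 < r → r ≤ 1 →
    c * r ^ d ≤ I.covLaw.real (Metric.closedBall x r) ∧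
      I.covLaw.real (Metric.closedBall x r) ≤ C * r ^ d

/-- The class of pricing problems with Lipschitz constant `CLip` and ball-mass constants
`cQ`, `CQ`. -/
def problemClass (d : ℕ) (CLip cQ CQ : ℝ) : Set (Problem d) :=
  {I | LipschitzReward CLip I ∧ BallMass cQ CQ I}

end DynamicPricing

end

noncomputable section

namespace DynamicPricing

open scoped ENNReal NNReal

variable {d : ℕ}

/-! Cut the covariate cube into `M^d` cells of side `1/M` and the prices into `M` bins. Take uniform
covariates and Bernoulli revenues. For each map `σ` from cells to bins, let the reward be `1/2`
plus, over each cell `j`, a cone of height of order `1/M` centred at bin `σ j`. When the covariate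
is in the core of cell `j`, missing bin `σ j` costs order `1/M` (`le_fStar_sub`). So if, on average
over `σ`, the favoured bin is chosen in at most half of the core rounds, the regret is of order
`n/M`.

To see that it is, fix a cell and erase its peak. The data then carry no information on `σ j`, and
the `M` disjoint bins share the roughly `n M^(-d)` rounds spent in the cell. Putting a peak back at
bin `k` costs relative entropy at most a constant times `M^(-2)` per visit to that bin, hence on
average over `k` order `n / M^(d+3)`. By `expTotal_change_le`, small entropy means that visit counts
hardly change. When `256 n ≤ M^(d+3)` and `M ≥ 4`, the favoured bin gets on average at most a
fraction `1/M + 1/16 + 1/8 ≤ 1/2` (`sum_visits_update_le`). Averaging over `σ` produces one hard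
problem (`exists_le_regret`), and `M` of order `n^(1/(d+3))` gives the rate.

Entropy enters through a bound on total variation that is linear in the divergence
(`integral_abs_likelihood_sub_one_le`), in place of Pinsker's inequality; the errors for different
bins can therefore simply be added. -/

/-! ### Expected totals along the interaction. -/

theorem integrable_of_bounded {α : Type*} [MeasurableSpace α] (μ : Measure α) [IsFiniteMeasure μ]
    {F : α → ℝ} (hF : Measurable F) {C : ℝ} (hC : ∀ a, |F a| ≤ C) : Integrable F μ :=
  Integrable.of_bound hF.aestronglyMeasurable C (Filter.Eventually.of_forall hC)

theorem lintegral_stepKernel (π : Policy d) (I : Problem d) (t : ℕ) (h : Fin t → Obs d)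
    {F : Obs d → ℝ≥0∞} (hF : Measurable F) :
    ∫⁻ o, F o ∂(stepKernel π I t h) =
      ∫⁻ x, ∫⁻ p, ∫⁻ y, F (x, p, y) ∂(I.revLaw (x, p)) ∂(π.price t (h, x)) ∂I.covLaw := by
  unfold stepKernel
  rw [Kernel.lintegral_compProd _ _ _ hF]
  simp only [Kernel.const_apply]
  refine lintegral_congr fun x => ?_
  rw [Kernel.lintegral_compProd _ _ _ (by fun_prop : Measurable fun q => F (x, q))]
  simp only [Kernel.comap_apply]

theorem integral_stepKernel (π : Policy d) (I : Problem d) (t : ℕ) (h : Fin t → Obs d)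
    {F : Obs d → ℝ} (hF : Measurable F) {C : ℝ} (hC : ∀ o, |F o| ≤ C) :
    ∫ o, F o ∂(stepKernel π I t h) =
      ∫ x, ∫ p, ∫ y, F (x, p, y) ∂(I.revLaw (x, p)) ∂(π.price t (h, x)) ∂I.covLaw := by
  unfold stepKernel
  rw [ProbabilityTheory.integral_compProd (integrable_of_bounded _ hF hC)]
  simp only [Kernel.const_apply]
  refine integral_congr_ae (Filter.Eventually.of_forall fun x => ?_)
  simp only
  rw [ProbabilityTheory.integral_compProd (integrable_of_bounded _
    (by fun_prop : Measurable fun q => F (x, q)) fun q => hC (x, q))]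
  simp only [Kernel.comap_apply]

theorem lintegral_law_succ (π : Policy d) (I : Problem d) (n : ℕ)
    {G : (Fin (n + 1) → Obs d) → ℝ≥0∞} (hG : Measurable G) :
    ∫⁻ h, G h ∂(law π I (n + 1)) =
      ∫⁻ h, ∫⁻ o, G (Fin.snoc (α := fun _ => Obs d) h o) ∂(stepKernel π I n h) ∂(law π I n) := by
  rw [law, lintegral_map hG (measurable_snoc n)]
  exact Measure.lintegral_compProd (hG.comp (measurable_snoc n))

theorem integral_law_succ (π : Policy d) (I : Problem d) (n : ℕ)
    {G : (Fin (n + 1) → Obs d) → ℝ} (hG : Measurable G) {C : ℝ} (hC : ∀ h, |G h| ≤ C) :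
    ∫ h, G h ∂(law π I (n + 1)) =
      ∫ h, ∫ o, G (Fin.snoc (α := fun _ => Obs d) h o) ∂(stepKernel π I n h) ∂(law π I n) := by
  rw [law, integral_map (measurable_snoc n).aemeasurable hG.aestronglyMeasurable]
  exact Measure.integral_compProd (integrable_of_bounded _ (hG.comp (measurable_snoc n))
    fun w => hC _)

/-- The expected total `∑_{t < n} E[F(X_t, p_t, Y_t)]`. -/
def expTotal (π : Policy d) (I : Problem d) (F : Obs d → ℝ) (n : ℕ) : ℝ :=
  ∫ h, ∑ t : Fin n, F (h t) ∂(law π I n)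

theorem measurable_total {F : Obs d → ℝ} (hF : Measurable F) (n : ℕ) :
    Measurable fun h : Fin n → Obs d => ∑ t : Fin n, F (h t) :=
  Finset.measurable_sum _ fun t _ => hF.comp (measurable_pi_apply t)

theorem abs_total_le {F : Obs d → ℝ} {C : ℝ} (hC : ∀ o, |F o| ≤ C) (n : ℕ)
    (h : Fin n → Obs d) : |∑ t : Fin n, F (h t)| ≤ n * C := by
  refine (Finset.abs_sum_le_sum_abs _ _).trans ?_
  refine (Finset.sum_le_sum fun t _ => hC (h t)).trans ?_
  simp

theorem integrable_total (π : Policy d) (I : Problem d) {F : Obs d → ℝ} (hF : Measurable F)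
    {C : ℝ} (hC : ∀ o, |F o| ≤ C) (n : ℕ) :
    Integrable (fun h : Fin n → Obs d => ∑ t : Fin n, F (h t)) (law π I n) :=
  integrable_of_bounded _ (measurable_total hF n) (abs_total_le hC n)

theorem expTotal_mono (π : Policy d) (I : Problem d) {F G : Obs d → ℝ} (hF : Measurable F)
    {C : ℝ} (hC : ∀ o, |F o| ≤ C) (hG : Measurable G) {D : ℝ} (hD : ∀ o, |G o| ≤ D)
    (hFG : ∀ o, F o ≤ G o) (n : ℕ) : expTotal π I F n ≤ expTotal π I G n :=
  integral_mono (integrable_total π I hF hC n) (integrable_total π I hG hD n)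
    fun _ => Finset.sum_le_sum fun _ _ => hFG _

theorem expTotal_const_mul (π : Policy d) (I : Problem d) (F : Obs d → ℝ) (a : ℝ) (n : ℕ) :
    expTotal π I (fun o => a * F o) n = a * expTotal π I F n := by
  simp only [expTotal, ← Finset.mul_sum, integral_const_mul]

theorem expTotal_sum (π : Policy d) (I : Problem d) {ι : Type*} (s : Finset ι)
    {F : ι → Obs d → ℝ} (hF : ∀ i, Measurable (F i)) {C : ℝ} (hC : ∀ i o, |F i o| ≤ C) (n : ℕ) :
    expTotal π I (fun o => ∑ i ∈ s, F i o) n = ∑ i ∈ s, expTotal π I (F i) n := by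
  simp only [expTotal]
  rw [← integral_finsetSum _ fun i _ => integrable_total π I (hF i) (hC i) n]
  congr 1
  ext h
  exact Finset.sum_comm

theorem expTotal_sub (π : Policy d) (I : Problem d) {F G : Obs d → ℝ} (hF : Measurable F)
    {C : ℝ} (hC : ∀ o, |F o| ≤ C) (hG : Measurable G) {D : ℝ} (hD : ∀ o, |G o| ≤ D) (n : ℕ) :
    expTotal π I (fun o => F o - G o) n = expTotal π I F n - expTotal π I G n := by
  simp only [expTotal, Finset.sum_sub_distrib]
  exact integral_sub (integrable_total π I hF hC n) (integrable_total π I hG hD n)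

theorem expTotal_zero (π : Policy d) (I : Problem d) (F : Obs d → ℝ) :
    expTotal π I F 0 = 0 := by
  simp [expTotal]

theorem expTotal_succ (π : Policy d) (I : Problem d) {F : Obs d → ℝ} (hF : Measurable F)
    {C : ℝ} (hC : ∀ o, |F o| ≤ C) (n : ℕ) :
    expTotal π I F (n + 1) =
      expTotal π I F n + ∫ h, ∫ o, F o ∂(stepKernel π I n h) ∂(law π I n) := by
  rw [expTotal, integral_law_succ π I n (measurable_total hF _) (abs_total_le hC _), expTotal,
    ← integral_add (integrable_total π I hF hC n)]
  · congr 1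
    ext h
    simp only [Fin.sum_univ_castSucc, Fin.snoc_castSucc, Fin.snoc_last]
    rw [integral_add (integrable_const _) (integrable_of_bounded _ hF hC)]
    simp
  · refine integrable_of_bounded _
      (hF.stronglyMeasurable.integral_kernel (κ := stepKernel π I n)).measurable (C := C)
      fun h => ?_
    refine (norm_integral_le_of_norm_le_const (f := F) (C := C) (Filter.Eventually.of_forall hC)).trans ?_
    simp

theorem expTotal_nonneg (π : Policy d) (I : Problem d) {F : Obs d → ℝ} (hF : ∀ o, 0 ≤ F o)
    (n : ℕ) : 0 ≤ expTotal π I F n :=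
  integral_nonneg fun _ => Finset.sum_nonneg fun _ _ => hF _

theorem expTotal_monotone (π : Policy d) (I : Problem d) {F : Obs d → ℝ} (hF : Measurable F)
    {C : ℝ} (hC : ∀ o, |F o| ≤ C) (h0 : ∀ o, 0 ≤ F o) : Monotone (expTotal π I F) := by
  refine monotone_nat_of_le_succ fun n => ?_
  rw [expTotal_succ π I hF hC]
  exact le_add_of_nonneg_right (integral_nonneg fun _ => integral_nonneg h0)

theorem expTotal_covariate (π : Policy d) (I : Problem d) {g : Covariate d → ℝ}
    (hg : Measurable g) {C : ℝ} (hC : ∀ x, |g x| ≤ C) (n : ℕ) :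
    expTotal π I (fun o => g o.1) n = n * ∫ x, g x ∂I.covLaw := by
  induction n with
  | zero => simp [expTotal_zero]
  | succ n ih =>
    have hm : Measurable fun o : Obs d => g o.1 := hg.comp measurable_fst
    rw [expTotal_succ π I hm fun o => hC _, ih]
    simp only [integral_stepKernel π I n _ hm fun o => hC _]
    simp
    ring

theorem regret_eq_expTotal (π : Policy d) (I : Problem d)
    (hm : Measurable fun o : Obs d => I.fStar o.1 - (I.f (o.1, o.2.1) : ℝ)) {C : ℝ}
    (hC : ∀ o : Obs d, |I.fStar o.1 - (I.f (o.1, o.2.1) : ℝ)| ≤ C) (n : ℕ) :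
    regret π I n = expTotal π I (fun o => I.fStar o.1 - (I.f (o.1, o.2.1) : ℝ)) n := by
  rw [regret, expTotal, integral_finsetSum]
  exact fun t _ => integrable_of_bounded _ (hm.comp (measurable_pi_apply t)) fun h => hC _

/-! ### Uniform covariates and Bernoulli revenues. -/

/-- The kernel sending `z` to the Bernoulli law on `{0, 1}` with mean `f z`. -/
def bernoulliKernel (f : Covariate d × Price → unitInterval) (hf : Measurable f) :
    Kernel (Covariate d × Price) Revenue where
  toFun z := ENNReal.ofReal (f z) • Measure.dirac 1 + ENNReal.ofReal (1 - f z) • Measure.dirac 0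
  measurable' := by
    refine Measure.measurable_of_measurable_coe _ fun s hs => ?_
    simp only [Measure.coe_add, Measure.coe_smul, Pi.add_apply, Pi.smul_apply, smul_eq_mul]
    fun_prop

theorem lintegral_bernoulliKernel (f : Covariate d × Price → unitInterval) (hf : Measurable f)
    (z : Covariate d × Price) (G : Revenue → ℝ≥0∞) :
    ∫⁻ y, G y ∂(bernoulliKernel f hf z) =
      ENNReal.ofReal (f z) * G 1 + ENNReal.ofReal (1 - f z) * G 0 := by
  change ∫⁻ y, G y ∂(ENNReal.ofReal (f z) • Measure.dirac 1 +
    ENNReal.ofReal (1 - f z) • Measure.dirac 0) = _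
  simp [lintegral_add_measure]

theorem integral_bernoulliKernel (f : Covariate d × Price → unitInterval) (hf : Measurable f)
    (z : Covariate d × Price) (G : Revenue → ℝ) :
    ∫ y, G y ∂(bernoulliKernel f hf z) = f z * G 1 + (1 - f z) * G 0 := by
  change ∫ y, G y ∂(ENNReal.ofReal (f z) • Measure.dirac 1 +
    ENNReal.ofReal (1 - f z) • Measure.dirac 0) = _
  rw [integral_add_measure ((integrable_dirac (by simp)).smul_measure (by simp))
    ((integrable_dirac (by simp)).smul_measure (by simp))]
  simp only [integral_smul_measure, integral_dirac, smul_eq_mul]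
  rw [ENNReal.toReal_ofReal (f z).2.1, ENNReal.toReal_ofReal (sub_nonneg.2 (f z).2.2)]

/-- The problem with uniform covariates and Bernoulli revenues of mean `f`. -/
def uniformProblem (f : Covariate d × Price → unitInterval) (hf : Measurable f) : Problem d where
  covLaw := volume
  isProb := inferInstance
  f := f
  revLaw := bernoulliKernel f hf
  isMarkov := ⟨fun z => ⟨by
    rw [← lintegral_one, lintegral_bernoulliKernel, mul_one, mul_one,
      ← ENNReal.ofReal_add (f z).2.1 (sub_nonneg.2 (f z).2.2)]
    simp⟩⟩
  mean_revLaw z := by rw [integral_bernoulliKernel]; simp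

theorem integral_stepKernel_uniformProblem (π : Policy d) {f : Covariate d × Price → unitInterval}
    (hf : Measurable f) (t : ℕ) (h : Fin t → Obs d) {F : Obs d → ℝ} (hF : Measurable F) {C : ℝ}
    (hC : ∀ o, |F o| ≤ C) :
    ∫ o, F o ∂(stepKernel π (uniformProblem f hf) t h) =
      ∫ x, ∫ p, (f (x, p) * F (x, p, 1) + (1 - f (x, p)) * F (x, p, 0))
        ∂(π.price t (h, x)) := by
  rw [integral_stepKernel π _ t h hF hC]
  simp only [uniformProblem, integral_bernoulliKernel]

/-- Tower property: in each round the revenue can be averaged out given covariate and price. It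
turns the expected log-likelihood into a sum of Bernoulli divergences. -/
theorem expTotal_uniformProblem (π : Policy d) {f : Covariate d × Price → unitInterval}
    (hf : Measurable f) {F : Obs d → ℝ} (hF : Measurable F) {C : ℝ} (hC : ∀ o, |F o| ≤ C)
    (n : ℕ) :
    expTotal π (uniformProblem f hf) F n = expTotal π (uniformProblem f hf)
      (fun o => f (o.1, o.2.1) * F (o.1, o.2.1, 1) +
        (1 - f (o.1, o.2.1)) * F (o.1, o.2.1, 0)) n := by
  have hm : Measurable fun o : Obs d => (f (o.1, o.2.1) * F (o.1, o.2.1, 1) +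
        (1 - f (o.1, o.2.1)) * F (o.1, o.2.1, 0) : ℝ) := by fun_prop
  have hb : ∀ o : Obs d, |(f (o.1, o.2.1) * F (o.1, o.2.1, 1) +
        (1 - f (o.1, o.2.1)) * F (o.1, o.2.1, 0) : ℝ)| ≤ C := by
    intro o
    have h1 := abs_le.1 (hC (o.1, o.2.1, 1))
    have h2 := abs_le.1 (hC (o.1, o.2.1, 0))
    have h3 := (f (o.1, o.2.1)).2.1
    have h4 := (f (o.1, o.2.1)).2.2
    rw [abs_le]
    constructor <;> nlinarith
  induction n with
  | zero => simp [expTotal_zero]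
  | succ n ih =>
    rw [expTotal_succ π _ hF hC, expTotal_succ π _ hm hb, ih]
    simp only [integral_stepKernel_uniformProblem π hf n _ hF hC,
      integral_stepKernel_uniformProblem π hf n _ hm hb]
    congr! 7
    ring

/-! ### Likelihood ratios. -/

/-- The likelihood ratio of one Bernoulli revenue of mean `f₁` against mean `f₀`. -/
def revenueRatio (f₀ f₁ : Covariate d × Price → unitInterval) (o : Obs d) : ℝ≥0 :=
  if o.2.2 = 1 then Real.toNNReal (f₁ (o.1, o.2.1) / f₀ (o.1, o.2.1))
  else Real.toNNReal ((1 - f₁ (o.1, o.2.1)) / (1 - f₀ (o.1, o.2.1)))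

theorem measurable_revenueRatio {f₀ f₁ : Covariate d × Price → unitInterval} (h₀ : Measurable f₀)
    (h₁ : Measurable f₁) : Measurable (revenueRatio f₀ f₁) := by
  unfold revenueRatio
  refine Measurable.ite ?_ (by fun_prop) (by fun_prop)
  exact measurableSet_eq_fun (by fun_prop) (by fun_prop)

/-- The reward function takes values in `[1/2, 3/4]`. -/
def MidRange (f : Covariate d × Price → unitInterval) : Prop :=
  ∀ z, (1 / 2 : ℝ) ≤ f z ∧ (f z : ℝ) ≤ 3 / 4

theorem revenueRatio_bounds {f₀ f₁ : Covariate d × Price → unitInterval} (h₀ : MidRange f₀)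
    (h₁ : MidRange f₁) (o : Obs d) :
    (1 / 2 : ℝ) ≤ revenueRatio f₀ f₁ o ∧ (revenueRatio f₀ f₁ o : ℝ) ≤ 2 := by
  obtain ⟨a, b⟩ := h₀ (o.1, o.2.1)
  obtain ⟨a', b'⟩ := h₁ (o.1, o.2.1)
  unfold revenueRatio
  split_ifs
  · have hp : (0 : ℝ) < f₀ (o.1, o.2.1) := by linarith
    rw [Real.coe_toNNReal _ (by positivity), le_div_iff₀ hp, div_le_iff₀ hp]
    constructor <;> linarith
  · have hp : (0 : ℝ) < 1 - f₀ (o.1, o.2.1) := by linarith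
    rw [Real.coe_toNNReal _ (div_nonneg (by linarith) hp.le), le_div_iff₀ hp, div_le_iff₀ hp]
    constructor <;> linarith

/-- The covariate law and the policy are common to both problems, so only the revenue factor is
reweighted; `MidRange f₀` keeps both denominators nonzero. -/
theorem lintegral_stepKernel_change (π : Policy d) {f₀ f₁ : Covariate d × Price → unitInterval}
    (h₀ : Measurable f₀) (h₁ : Measurable f₁) (hr : MidRange f₀) (t : ℕ)
    (h : Fin t → Obs d) {F : Obs d → ℝ≥0∞} (hF : Measurable F) :
    ∫⁻ o, F o ∂(stepKernel π (uniformProblem f₁ h₁) t h) =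
      ∫⁻ o, revenueRatio f₀ f₁ o * F o ∂(stepKernel π (uniformProblem f₀ h₀) t h) := by
  have hm := measurable_revenueRatio h₀ h₁
  rw [lintegral_stepKernel π _ t h hF, lintegral_stepKernel π _ t h (by fun_prop)]
  simp only [uniformProblem, lintegral_bernoulliKernel]
  refine lintegral_congr fun x => lintegral_congr fun p => ?_
  obtain ⟨a, b⟩ := hr (x, p)
  rw [← mul_assoc, ← mul_assoc]
  congr 2
  · simp only [revenueRatio, if_true]
    change _ = _ * ENNReal.ofReal _
    rw [← ENNReal.ofReal_mul (by linarith), mul_div_cancel₀ _ (by linarith)]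
  · simp only [revenueRatio, zero_ne_one, if_false]
    change _ = _ * ENNReal.ofReal _
    rw [← ENNReal.ofReal_mul (by linarith), mul_div_cancel₀ _ (by linarith)]

/-- The likelihood ratio of a history. -/
def likelihood (f₀ f₁ : Covariate d × Price → unitInterval) (n : ℕ) (h : Fin n → Obs d) : ℝ≥0 :=
  ∏ t : Fin n, revenueRatio f₀ f₁ (h t)

theorem measurable_likelihood {f₀ f₁ : Covariate d × Price → unitInterval} (h₀ : Measurable f₀)
    (h₁ : Measurable f₁) (n : ℕ) : Measurable (likelihood f₀ f₁ n) :=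
  Finset.measurable_prod _ fun t _ =>
    (measurable_revenueRatio h₀ h₁).comp (measurable_pi_apply t)

theorem lintegral_law_change (π : Policy d) {f₀ f₁ : Covariate d × Price → unitInterval}
    (h₀ : Measurable f₀) (h₁ : Measurable f₁) (hr : MidRange f₀) (n : ℕ)
    {G : (Fin n → Obs d) → ℝ≥0∞} (hG : Measurable G) :
    ∫⁻ h, G h ∂(law π (uniformProblem f₁ h₁) n) =
      ∫⁻ h, likelihood f₀ f₁ n h * G h ∂(law π (uniformProblem f₀ h₀) n) := by
  induction n with
  | zero => simp [law, likelihood]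
  | succ n ih =>
    have hm := measurable_likelihood h₀ h₁ (n + 1)
    have hm' := measurable_revenueRatio h₀ h₁
    have hs : ∀ h : Fin n → Obs d, Measurable fun o =>
        G (Fin.snoc (α := fun _ => Obs d) h o) := fun h =>
      (hG.comp (measurable_snoc n)).comp (by fun_prop : Measurable fun o : Obs d => (h, o))
    rw [lintegral_law_succ π _ n hG, lintegral_law_succ π _ n (by fun_prop), ih]
    · refine lintegral_congr fun h => ?_
      rw [lintegral_stepKernel_change π h₀ h₁ hr n h (hs h),
        ← lintegral_const_mul _ (by have := hs h; fun_prop)]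
      simp only [likelihood, Fin.prod_univ_castSucc, Fin.snoc_castSucc, Fin.snoc_last,
        ENNReal.coe_mul, mul_assoc]
    · exact (hG.comp (measurable_snoc n)).lintegral_kernel_prod_right'

theorem law_eq_withDensity (π : Policy d) {f₀ f₁ : Covariate d × Price → unitInterval}
    (h₀ : Measurable f₀) (h₁ : Measurable f₁) (hr : MidRange f₀) (n : ℕ) :
    law π (uniformProblem f₁ h₁) n =
      (law π (uniformProblem f₀ h₀) n).withDensity fun h => likelihood f₀ f₁ n h := by
  ext s hs
  rw [withDensity_apply _ hs, ← lintegral_indicator_one hs,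
    lintegral_law_change π h₀ h₁ hr n (measurable_one.indicator hs), ← lintegral_indicator hs]
  congr 1
  ext h
  by_cases hh : h ∈ s <;> simp [hh]

theorem integral_law_change (π : Policy d) {f₀ f₁ : Covariate d × Price → unitInterval}
    (h₀ : Measurable f₀) (h₁ : Measurable f₁) (hr : MidRange f₀) (n : ℕ)
    (G : (Fin n → Obs d) → ℝ) :
    ∫ h, G h ∂(law π (uniformProblem f₁ h₁) n) =
      ∫ h, likelihood f₀ f₁ n h * G h ∂(law π (uniformProblem f₀ h₀) n) := by
  rw [law_eq_withDensity π h₀ h₁ hr,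
    integral_withDensity_eq_integral_smul (measurable_likelihood h₀ h₁ n)]
  rfl

/-! ### From relative entropy to change of measure. -/

/-- With `z = s²`, `log s ≤ s - 1` gives `z - 1 - log z ≥ (s - 1)²`, while AM-GM gives `|s - 1|(s +
1) ≤ 8(s - 1)² + (s + 1)²/32`, and `(s + 1)² ≤ 2(z + 1)`. -/
theorem abs_sub_one_le {z : ℝ} (hz : 0 < z) :
    |z - 1| ≤ 8 * (z - 1 - Real.log z) + (z + 1) / 16 := by
  obtain ⟨s, hs, rfl⟩ : ∃ s : ℝ, 0 < s ∧ z = s ^ 2 :=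
    ⟨√z, Real.sqrt_pos.2 hz, (Real.sq_sqrt hz.le).symm⟩
  have hl := Real.log_le_sub_one_of_pos hs
  rw [Real.log_pow, abs_le]
  push_cast
  constructor <;>
    nlinarith [sq_nonneg (8 * (s - 1) - (s + 1) / 2), sq_nonneg (8 * (s - 1) + (s + 1) / 2),
      sq_nonneg (s - 1)]

/-- The divergence is at most the chi-square distance `(b - a)² / (b(1 - b))`, and `b(1 - b) ≥ 1/8`
on this range. -/
theorem kl_bernoulli_le {a b : ℝ} (ha : 1 / 2 ≤ a) (ha' : a ≤ 3 / 4) (hb : 1 / 2 ≤ b)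
    (hb' : b ≤ 3 / 4) :
    a * -Real.log (b / a) + (1 - a) * -Real.log ((1 - b) / (1 - a)) ≤ 8 * (b - a) ^ 2 := by
  have h1 : -Real.log (b / a) ≤ a / b - 1 := by
    rw [← Real.log_inv, inv_div]
    exact Real.log_le_sub_one_of_pos (div_pos (by linarith) (by linarith))
  have h2 : -Real.log ((1 - b) / (1 - a)) ≤ (1 - a) / (1 - b) - 1 := by
    rw [← Real.log_inv, inv_div]
    exact Real.log_le_sub_one_of_pos (div_pos (by linarith) (by linarith))
  have hb0 : b ≠ 0 := by linarith
  have hb1 : 1 - b ≠ 0 := by linarith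
  calc _ ≤ a * (a / b - 1) + (1 - a) * ((1 - a) / (1 - b) - 1) :=
        add_le_add (mul_le_mul_of_nonneg_left h1 (by linarith))
          (mul_le_mul_of_nonneg_left h2 (by linarith))
    _ = (b - a) ^ 2 / (b * (1 - b)) := by field_simp; ring
    _ ≤ 8 * (b - a) ^ 2 := by
        rw [div_le_iff₀ (by nlinarith)]
        have : 1 ≤ 8 * (b * (1 - b)) := by nlinarith
        nlinarith [mul_le_mul_of_nonneg_left this (sq_nonneg (b - a))]

theorem likelihood_bounds {f₀ f₁ : Covariate d × Price → unitInterval} (h₀ : MidRange f₀)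
    (h₁ : MidRange f₁) (n : ℕ) (h : Fin n → Obs d) :
    0 < (likelihood f₀ f₁ n h : ℝ) ∧ (likelihood f₀ f₁ n h : ℝ) ≤ 2 ^ n := by
  rw [likelihood, NNReal.coe_prod]
  constructor
  · exact Finset.prod_pos fun t _ => by linarith [(revenueRatio_bounds h₀ h₁ (h t)).1]
  · exact (Finset.prod_le_prod (fun _ _ => NNReal.coe_nonneg _) fun t _ =>
      (revenueRatio_bounds h₀ h₁ (h t)).2).trans (by simp)

theorem abs_log_revenueRatio_le {f₀ f₁ : Covariate d × Price → unitInterval} (h₀ : MidRange f₀)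
    (h₁ : MidRange f₁) (o : Obs d) : |-Real.log (revenueRatio f₀ f₁ o)| ≤ 1 := by
  obtain ⟨a, b⟩ := revenueRatio_bounds h₀ h₁ o
  have hp : (0 : ℝ) < revenueRatio f₀ f₁ o := by linarith
  rw [abs_neg, abs_le]
  constructor
  · have := Real.log_le_sub_one_of_pos (inv_pos.2 hp)
    rw [Real.log_inv] at this
    have : (revenueRatio f₀ f₁ o : ℝ)⁻¹ ≤ 2 := by
      rw [inv_le_comm₀ hp two_pos]; linarith
    linarith
  · linarith [Real.log_le_sub_one_of_pos hp]

theorem expTotal_neg_log_le (π : Policy d) {f₀ f₁ : Covariate d × Price → unitInterval}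
    (h₀ : Measurable f₀) (h₁ : Measurable f₁) (hr₀ : MidRange f₀) (hr₁ : MidRange f₁) (n : ℕ) :
    expTotal π (uniformProblem f₀ h₀) (fun o => -Real.log (revenueRatio f₀ f₁ o)) n ≤
      8 * expTotal π (uniformProblem f₀ h₀)
        (fun o => ((f₁ (o.1, o.2.1) : ℝ) - f₀ (o.1, o.2.1)) ^ 2) n := by
  have hm := measurable_revenueRatio h₀ h₁
  rw [expTotal_uniformProblem π h₀ (by fun_prop) (abs_log_revenueRatio_le hr₀ hr₁),
    ← expTotal_const_mul]
  refine expTotal_mono π _ (C := 1) (by fun_prop) (fun o => ?_) (D := 8) (by fun_prop)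
    (fun o => ?_) (fun o => ?_) n
  · have h1 := abs_le.1 (abs_log_revenueRatio_le hr₀ hr₁ (o.1, o.2.1, 1))
    have h2 := abs_le.1 (abs_log_revenueRatio_le hr₀ hr₁ (o.1, o.2.1, 0))
    have h3 := (f₀ (o.1, o.2.1)).2.1
    have h4 := (f₀ (o.1, o.2.1)).2.2
    rw [abs_le]
    constructor <;> nlinarith
  · obtain ⟨a, b⟩ := hr₀ (o.1, o.2.1)
    obtain ⟨a', b'⟩ := hr₁ (o.1, o.2.1)
    rw [abs_of_nonneg (by positivity)]
    nlinarith
  · obtain ⟨a, b⟩ := hr₀ (o.1, o.2.1)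
    obtain ⟨a', b'⟩ := hr₁ (o.1, o.2.1)
    refine le_trans (le_of_eq ?_) (kl_bernoulli_le a b a' b')
    simp only [revenueRatio, if_true, zero_ne_one, if_false]
    rw [Real.coe_toNNReal _ (div_nonneg (by linarith) (by linarith)),
      Real.coe_toNNReal _ (div_nonneg (by linarith) (by linarith))]

/-- Integrate `abs_sub_one_le` at the likelihood ratio `Z`: since `E Z = 1`, the term `Z - 1 - log
Z` becomes the relative entropy and `(Z + 1)/16` becomes `1/8`. -/
theorem integral_abs_likelihood_sub_one_le (π : Policy d)
    {f₀ f₁ : Covariate d × Price → unitInterval}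
    (h₀ : Measurable f₀) (h₁ : Measurable f₁) (hr₀ : MidRange f₀) (hr₁ : MidRange f₁) (n : ℕ) :
    ∫ h, |(likelihood f₀ f₁ n h : ℝ) - 1| ∂(law π (uniformProblem f₀ h₀) n) ≤
      64 * expTotal π (uniformProblem f₀ h₀)
        (fun o => ((f₁ (o.1, o.2.1) : ℝ) - f₀ (o.1, o.2.1)) ^ 2) n + 1 / 8 := by
  have hm := measurable_likelihood h₀ h₁ n
  have hmr := measurable_revenueRatio h₀ h₁
  have hZ : Integrable (fun h => (likelihood f₀ f₁ n h : ℝ)) (law π (uniformProblem f₀ h₀) n) :=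
    integrable_of_bounded _ (by fun_prop) (C := 2 ^ n) fun h => by
      rw [abs_of_nonneg (NNReal.coe_nonneg _)]; exact (likelihood_bounds hr₀ hr₁ n h).2
  have hlog : ∀ h, -Real.log (likelihood f₀ f₁ n h) =
      ∑ t : Fin n, -Real.log (revenueRatio f₀ f₁ (h t)) := fun h => by
    rw [likelihood, NNReal.coe_prod, Real.log_prod, Finset.sum_neg_distrib]
    exact fun t _ => by linarith [(revenueRatio_bounds hr₀ hr₁ (h t)).1]
  have hlogI : Integrable (fun h => -Real.log (likelihood f₀ f₁ n h))
      (law π (uniformProblem f₀ h₀) n) := by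
    simp only [hlog]
    exact integrable_total π _ (F := fun o => -Real.log (revenueRatio f₀ f₁ o)) (by fun_prop)
      (abs_log_revenueRatio_le hr₀ hr₁) n
  have hone : ∫ h, (likelihood f₀ f₁ n h : ℝ) ∂(law π (uniformProblem f₀ h₀) n) = 1 := by
    have := integral_law_change π h₀ h₁ hr₀ n fun _ => 1
    simpa using this.symm
  have hle := expTotal_neg_log_le π h₀ h₁ hr₀ hr₁ n
  rw [expTotal] at hle
  simp only [← hlog] at hle
  calc _ ≤ ∫ h, (8 * (-Real.log (likelihood f₀ f₁ n h)) +
        ((129 / 16) * (likelihood f₀ f₁ n h : ℝ) + (-127 / 16)))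
          ∂(law π (uniformProblem f₀ h₀) n) := by
        refine integral_mono (hZ.sub (integrable_const 1)).abs
          ((hlogI.const_mul 8).add ((hZ.const_mul _).add (integrable_const _))) fun h => ?_
        have := abs_sub_one_le (likelihood_bounds hr₀ hr₁ n h).1
        simp only
        linarith
    _ = 8 * ∫ h, -Real.log (likelihood f₀ f₁ n h) ∂(law π (uniformProblem f₀ h₀) n) + 1 / 8 := by
        have hZ' := hZ.const_mul (129 / 16)
        have hZ'' : Integrable (fun h => 129 / 16 * (likelihood f₀ f₁ n h : ℝ) + -127 / 16)
            (law π (uniformProblem f₀ h₀) n) := hZ'.add (integrable_const _)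
        rw [integral_add (hlogI.const_mul 8) hZ'', integral_add hZ' (integrable_const _),
          integral_const_mul, integral_const_mul, hone]
        simp
        norm_num
    _ ≤ _ := by linarith

/-- Change of measure: the expected number of visits to a region of covariate mass at most `q`
under the reward function `f₁`, compared with that under `f₀`. -/
theorem expTotal_change_le (π : Policy d) {f₀ f₁ : Covariate d × Price → unitInterval}
    (h₀ : Measurable f₀) (h₁ : Measurable f₁) (hr₀ : MidRange f₀) (hr₁ : MidRange f₁)
    {F : Covariate d × Price → ℝ} (hF : Measurable F) {g : Covariate d → ℝ} (hg : Measurable g)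
    (hF0 : ∀ z, 0 ≤ F z) (hFg : ∀ z, F z ≤ g z.1) (hg1 : ∀ x, g x ≤ 1) (n : ℕ) :
    expTotal π (uniformProblem f₁ h₁) (fun o => F (o.1, o.2.1)) n ≤
      expTotal π (uniformProblem f₀ h₀) (fun o => F (o.1, o.2.1)) n + n * ((∫ x, g x) *
        (64 * expTotal π (uniformProblem f₀ h₀)
          (fun o => ((f₁ (o.1, o.2.1) : ℝ) - f₀ (o.1, o.2.1)) ^ 2) n + 1 / 8)) := by
  set D := expTotal π (uniformProblem f₀ h₀)
          (fun o => ((f₁ (o.1, o.2.1) : ℝ) - f₀ (o.1, o.2.1)) ^ 2)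
  have hD : Monotone D := expTotal_monotone π _ (by fun_prop) (C := 1) (fun o => by
    obtain ⟨a, b⟩ := hr₀ (o.1, o.2.1)
    obtain ⟨a', b'⟩ := hr₁ (o.1, o.2.1)
    rw [abs_of_nonneg (by positivity)]
    nlinarith) fun o => sq_nonneg _
  have hmF : Measurable fun o : Obs d => F (o.1, o.2.1) := by fun_prop
  have hbF : ∀ o : Obs d, |F (o.1, o.2.1)| ≤ 1 := fun o => by
    rw [abs_of_nonneg (hF0 _)]; exact (hFg _).trans (hg1 _)
  have hmg : Measurable fun o : Obs d => g o.1 := by fun_prop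
  have hg0 : ∀ x, 0 ≤ g x := fun x => (hF0 (x, 0)).trans (hFg (x, 0))
  have hbg : ∀ x, |g x| ≤ 1 := fun x => by rw [abs_of_nonneg (hg0 x)]; exact hg1 x
  have hG0 : 0 ≤ ∫ x, g x := integral_nonneg hg0
  -- The divergence is frozen at its final value `D n`, so every round of the induction pays the
  -- same error.
  suffices H : ∀ m ≤ n, expTotal π (uniformProblem f₁ h₁) (fun o => F (o.1, o.2.1)) m ≤
      expTotal π (uniformProblem f₀ h₀) (fun o => F (o.1, o.2.1)) m + m * ((∫ x, g x) *
        (64 * D n + 1 / 8)) from H n le_rfl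
  intro m hm
  induction m with
  | zero => simp [expTotal_zero]
  | succ m ih =>
    have ih := ih (by omega)
    rw [expTotal_succ π _ hmF hbF, expTotal_succ π _ hmF hbF]
    set u : (Fin m → Obs d) → ℝ :=
      fun h => ∫ o, F (o.1, o.2.1) ∂(stepKernel π (uniformProblem f₀ h₀) m h) with hu
    -- `F` ignores the revenue, so given the past its one-round mean does not depend on the reward
    -- function.
    have hueq : ∀ h, ∫ o, F (o.1, o.2.1) ∂(stepKernel π (uniformProblem f₁ h₁) m h) = u h := by
      intro h
      simp only [hu, integral_stepKernel_uniformProblem π _ m h hmF hbF]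
      congr! 4
      ring
    have hu0 : ∀ h, 0 ≤ u h := fun h => integral_nonneg fun o => hF0 _
    -- The covariate is independent of the past. This puts the factor `∫ g`, the mass of the region,
    -- in front of the total-variation error.
    have hug : ∀ h, u h ≤ ∫ x, g x := fun h => by
      refine (integral_mono (integrable_of_bounded _ hmF hbF)
        (integrable_of_bounded _ hmg fun o => hbg o.1) fun o => hFg (o.1, o.2.1)).trans_eq ?_
      rw [integral_stepKernel_uniformProblem π _ m h hmg fun o => hbg o.1]
      congr 1
      ext x
      have hc : ∀ a b : ℝ, a * b + (1 - a) * b = b := fun a b => by ring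
      simp [hc]
    have hum : Measurable u :=
      (hmF.stronglyMeasurable.integral_kernel
        (κ := stepKernel π (uniformProblem f₀ h₀) m)).measurable
    have hub : ∀ h, |u h| ≤ ∫ x, g x := fun h => by
      rw [abs_of_nonneg (hu0 h)]; exact hug h
    simp only [hueq]
    rw [integral_law_change π h₀ h₁ hr₀ m]
    have hml := measurable_likelihood h₀ h₁ m
    have hlb : ∀ h, |(likelihood f₀ f₁ m h : ℝ)| ≤ 2 ^ m := fun h => by
      rw [abs_of_nonneg (NNReal.coe_nonneg _)]; exact (likelihood_bounds hr₀ hr₁ m h).2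
    have hZ : Integrable (fun h => (likelihood f₀ f₁ m h : ℝ)) (law π (uniformProblem f₀ h₀) m) :=
      integrable_of_bounded _ (by fun_prop) hlb
    have hui := integrable_of_bounded (law π (uniformProblem f₀ h₀) m) hum hub
    have hZu : Integrable (fun h => (likelihood f₀ f₁ m h : ℝ) * u h)
        (law π (uniformProblem f₀ h₀) m) :=
      integrable_of_bounded _ (by fun_prop) (C := 2 ^ m * ∫ x, g x) fun h => by
        rw [abs_mul]
        exact mul_le_mul (hlb h) (hub h) (abs_nonneg _) (by positivity)
    have key : ∫ h, (likelihood f₀ f₁ m h : ℝ) * u h ∂(law π (uniformProblem f₀ h₀) m) ≤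
        ∫ h, u h ∂(law π (uniformProblem f₀ h₀) m) + (∫ x, g x) * (64 * D n + 1 / 8) := by
      calc _ ≤ ∫ h, (u h + (∫ x, g x) * |(likelihood f₀ f₁ m h : ℝ) - 1|)
            ∂(law π (uniformProblem f₀ h₀) m) := by
            refine integral_mono hZu
              (hui.add ((hZ.sub (integrable_const 1)).abs.const_mul _)) fun h => ?_
            have h1 := le_abs_self ((likelihood f₀ f₁ m h : ℝ) - 1)
            have h2 := mul_le_mul_of_nonneg_right h1 (hu0 h)
            have h3 := mul_le_mul_of_nonneg_right (hug h)
              (abs_nonneg ((likelihood f₀ f₁ m h : ℝ) - 1))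
            simp only
            linarith
        _ = ∫ h, u h ∂(law π (uniformProblem f₀ h₀) m) + (∫ x, g x) *
            ∫ h, |(likelihood f₀ f₁ m h : ℝ) - 1| ∂(law π (uniformProblem f₀ h₀) m) := by
            have hZ' : Integrable (fun h => (∫ x, g x) * |(likelihood f₀ f₁ m h : ℝ) - 1|)
                (law π (uniformProblem f₀ h₀) m) :=
              (hZ.sub (integrable_const 1)).abs.const_mul _
            rw [integral_add hui hZ', integral_const_mul]
        _ ≤ _ := by
            have h1 := integral_abs_likelihood_sub_one_le π h₀ h₁ hr₀ hr₁ m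
            have h2 : D m ≤ D n := hD (by omega)
            gcongr
            exact h1.trans (by simp only [D] at h2 ⊢; linarith)
    push_cast
    linarith

/-! ### Averaging and disjointness. -/

/-- Exchanging `k` with `σ j` is an involution on pairs `(σ, k)`. This allows one coordinate of a
uniformly random `σ` to be resampled. -/
theorem sum_sum_update {ι κ : Type*} [Fintype ι] [DecidableEq ι] [Fintype κ]
    (H : (ι → κ) → ℝ) (j : ι) :
    ∑ σ : ι → κ, ∑ k : κ, H (Function.update σ j k) = Fintype.card κ * ∑ σ, H σ := by
  have hinv : Function.Involutive fun p : (ι → κ) × κ => (Function.update p.1 j p.2, p.1 j) := by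
    rintro ⟨σ, k⟩
    simp
  rw [← Fintype.sum_prod_type' (f := fun σ k => H (Function.update σ j k)),
    Fintype.sum_equiv hinv.toPerm (fun p => H (Function.update p.1 j p.2)) (fun p => H p.1)
      fun _ => rfl, Fintype.sum_prod_type]
  simp [Finset.mul_sum]

theorem sum_indicator_le_one {α ι : Type*} [Fintype ι] {S : ι → Set α}
    (hS : Pairwise fun i j => Disjoint (S i) (S j)) (a : α) :
    ∑ i, (S i).indicator (1 : α → ℝ) a ≤ 1 := by
  classical
  by_cases h : ∃ i, a ∈ S i
  · obtain ⟨i, hi⟩ := h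
    rw [Finset.sum_eq_single i]
    · exact Set.indicator_le_self' (by simp) a
    · intro j _ hj
      exact Set.indicator_of_notMem (fun haj => Set.disjoint_left.1 (hS hj) haj hi) _
    · simp
  · push Not at h
    rw [Finset.sum_eq_zero fun i _ => Set.indicator_of_notMem (h i) _]
    exact zero_le_one

/-! ### Volumes of sup-norm balls. -/

section Volume

theorem closedBall_unitInterval (x : unitInterval) {r : ℝ} (hr : 0 ≤ r) :
    r ⊓ 1 ≤ (volume : Measure unitInterval).real (Metric.closedBall x r) ∧
      (volume : Measure unitInterval).real (Metric.closedBall x r) ≤ 2 * r := by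
  obtain ⟨hx0, hx1⟩ := x.2
  have hl : max 0 ((x : ℝ) - r) ∈ unitInterval := ⟨le_max_left _ _, max_le zero_le_one (by linarith)⟩
  have hu : min 1 ((x : ℝ) + r) ∈ unitInterval := ⟨le_min zero_le_one (by linarith), min_le_left _ _⟩
  have hball : Metric.closedBall x r =
      Set.Icc (⟨_, hl⟩ : unitInterval) (⟨_, hu⟩ : unitInterval) := by
    ext y
    have hy := y.2
    rw [Metric.mem_closedBall, Subtype.dist_eq, Real.dist_eq, abs_le, Set.mem_Icc,
      ← Subtype.coe_le_coe, ← Subtype.coe_le_coe]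
    simp only [max_le_iff, le_min_iff, hy.1, hy.2, true_and]
    constructor <;> rintro ⟨h1, h2⟩ <;> constructor <;> linarith
  rw [hball, measureReal_def, unitInterval.volume_Icc]
  have h1 : max 0 ((x : ℝ) - r) ≤ x := max_le hx0 (by linarith)
  have h2 : (x : ℝ) ≤ min 1 ((x : ℝ) + r) := le_min hx1 (by linarith)
  rw [ENNReal.toReal_ofReal (by simp only; linarith)]
  simp only
  constructor
  · rcases max_cases 0 ((x : ℝ) - r) with h | h <;> rcases min_cases 1 ((x : ℝ) + r) with h' | h' <;>
      rcases min_cases r 1 with h'' | h'' <;> linarith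
  · linarith [le_max_right 0 ((x : ℝ) - r), min_le_right 1 ((x : ℝ) + r)]

theorem volume_closedBall_covariate (x : Covariate d) {r : ℝ} (hr : 0 ≤ r) (hr1 : r ≤ 1) :
    r ^ d ≤ (volume : Measure (Covariate d)).real (Metric.closedBall x r) ∧
      (volume : Measure (Covariate d)).real (Metric.closedBall x r) ≤ (2 * r) ^ d := by
  have h : (volume : Measure (Covariate d)).real (Metric.closedBall x r) =
      ∏ i : Fin d, (volume : Measure unitInterval).real (Metric.closedBall (x i) r) := by
    rw [closedBall_pi x hr, measureReal_def, volume_pi_pi, ENNReal.toReal_prod]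
    rfl
  rw [h]
  constructor
  · calc r ^ d = ∏ _i : Fin d, r := by simp
      _ ≤ _ := Finset.prod_le_prod (fun _ _ => hr) fun i _ => by
        simpa [hr1] using (closedBall_unitInterval (x i) hr).1
  · calc _ ≤ ∏ _i : Fin d, 2 * r := Finset.prod_le_prod (fun _ _ => measureReal_nonneg)
          fun i _ => (closedBall_unitInterval (x i) hr).2
      _ = _ := by simp

theorem ballMass_uniformProblem {f : Covariate d × Price → unitInterval} (hf : Measurable f)
    {c C : ℝ} (hc : c ≤ 1) (hC : 2 ^ d ≤ C) : BallMass c C (uniformProblem f hf) := by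
  intro x _ r hr hr1
  obtain ⟨h1, h2⟩ := volume_closedBall_covariate x hr.le hr1
  constructor
  · exact (mul_le_of_le_one_left (by positivity) hc).trans h1
  · refine h2.trans ?_
    rw [mul_pow]
    gcongr

end Volume

/-! ### Cone-shaped rewards. -/

section Bump

variable {α ι : Type*} [PseudoMetricSpace α]

/-- The upper envelope of the cones of height and radius `w` around the points `a j`, `j ∈ T`. -/
def bump (w : ℝ) (T : Finset ι) (a : ι → α) (z : α) : ℝ≥0 :=
  T.sup fun j => Real.toNNReal (w - dist z (a j))

theorem bump_le {w : ℝ} (hw : 0 ≤ w) (T : Finset ι) (a : ι → α) (z : α) :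
    (bump w T a z : ℝ) ≤ w := by
  rw [← Real.le_toNNReal_iff_coe_le hw, bump]
  exact Finset.sup_le fun j _ => Real.toNNReal_le_toNNReal (by linarith [dist_nonneg (x := z) (y := a j)])

theorem le_bump (w : ℝ) {T : Finset ι} (a : ι → α) (z : α) {j : ι} (hj : j ∈ T) :
    w - dist z (a j) ≤ bump w T a z :=
  (Real.le_coe_toNNReal _).trans <| NNReal.coe_le_coe.2 <|
    Finset.le_sup (f := fun j => Real.toNNReal (w - dist z (a j))) hj

theorem bump_eq_zero {w : ℝ} {T : Finset ι} {a : ι → α} {z : α} (h : ∀ j ∈ T, w ≤ dist z (a j)) :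
    bump w T a z = 0 :=
  Finset.sup_eq_bot_iff _ _ |>.2 fun j hj => Real.toNNReal_of_nonpos (by linarith [h j hj])

theorem lipschitzWith_bump (w : ℝ) (T : Finset ι) (a : ι → α) (z z' : α) :
    (bump w T a z : ℝ) ≤ bump w T a z' + dist z z' := by
  have h : bump w T a z ≤ bump w T a z' + nndist z z' := by
    refine Finset.sup_le fun j hj => ?_
    rw [Real.toNNReal_le_iff_le_coe, NNReal.coe_add, coe_nndist]
    have := le_bump w a z' hj
    have := dist_triangle_left z' (a j) z
    linarith
  simpa using NNReal.coe_le_coe.2 h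

/-- Outside its radius the truncated cone `j` contributes zero to the supremum. The centre `b j` is
irrelevant. -/
theorem bump_erase_eq [DecidableEq ι] {w : ℝ} {T : Finset ι} {a b : ι → α} {j : ι}
    (hab : ∀ i, i ≠ j → a i = b i) {z : α} (hz : w ≤ dist z (a j)) :
    bump w (T.erase j) b z = bump w T a z := by
  refine le_antisymm (Finset.sup_le fun i hi => ?_) (Finset.sup_le fun i hi => ?_)
  · rw [← hab i (Finset.ne_of_mem_erase hi)]
    exact Finset.le_sup (f := fun j => Real.toNNReal (w - dist z (a j))) (Finset.mem_of_mem_erase hi)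
  · by_cases hij : i = j
    · subst hij
      rw [Real.toNNReal_of_nonpos (by linarith)]
      exact zero_le
    · rw [hab i hij]
      exact Finset.le_sup (f := fun j => Real.toNNReal (w - dist z (b j)))
        (Finset.mem_erase.2 ⟨hij, hi⟩)

/-- The baseline `1/2` plus `L` times the bump function. -/
def bumpReward (L w : ℝ) (T : Finset ι) (a : ι → α) (z : α) : unitInterval :=
  Set.projIcc 0 1 zero_le_one (1 / 2 + L * bump w T a z)

variable {L w : ℝ} (hL : 0 ≤ L) (hL1 : L ≤ 1) (hw : 0 ≤ w) (hw4 : w ≤ 1 / 4)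

include hL hL1 hw hw4

theorem mul_bump_le (T : Finset ι) (a : ι → α) (z : α) : L * bump w T a z ≤ L * w ∧ L * w ≤ 1 / 4 :=
  ⟨mul_le_mul_of_nonneg_left (bump_le hw T a z) hL, by nlinarith⟩

/-- The projection to `[0,1]` is inactive, because `L * w ≤ 1/4`. -/
theorem coe_bumpReward (T : Finset ι) (a : ι → α) (z : α) :
    (bumpReward L w T a z : ℝ) = 1 / 2 + L * bump w T a z := by
  have h0 : 0 ≤ L * bump w T a z := by positivity
  obtain ⟨h1, h2⟩ := mul_bump_le hL hL1 hw hw4 T a z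
  rw [bumpReward, Set.projIcc_of_mem zero_le_one ⟨by linarith, by linarith⟩]

theorem bumpReward_mem (T : Finset ι) (a : ι → α) (z : α) :
    (1 / 2 : ℝ) ≤ bumpReward L w T a z ∧ (bumpReward L w T a z : ℝ) ≤ 1 / 2 + L * w ∧
      (bumpReward L w T a z : ℝ) ≤ 3 / 4 := by
  have h0 : 0 ≤ L * bump w T a z := by positivity
  obtain ⟨h1, h2⟩ := mul_bump_le hL hL1 hw hw4 T a z
  rw [coe_bumpReward hL hL1 hw hw4]
  refine ⟨by linarith, by linarith, by linarith⟩

theorem abs_bumpReward_sub_le (T : Finset ι) (a : ι → α) (z z' : α) :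
    |(bumpReward L w T a z : ℝ) - bumpReward L w T a z'| ≤ L * dist z z' := by
  rw [coe_bumpReward hL hL1 hw hw4, coe_bumpReward hL hL1 hw hw4, add_sub_add_left_eq_sub,
    ← mul_sub, abs_mul, abs_of_nonneg hL]
  refine mul_le_mul_of_nonneg_left ?_ hL
  have h1 := lipschitzWith_bump w T a z z'
  have h2 := lipschitzWith_bump w T a z' z
  rw [dist_comm] at h2
  exact abs_le.2 ⟨by linarith, by linarith⟩

theorem continuous_bumpReward (T : Finset ι) (a : ι → α) : Continuous (bumpReward L w T a) := by
  refine LipschitzWith.continuous (K := L.toNNReal) (LipschitzWith.of_dist_le_mul fun z z' => ?_)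
  rw [Subtype.dist_eq, Real.dist_eq, Real.coe_toNNReal _ hL]
  exact abs_bumpReward_sub_le hL hL1 hw hw4 T a z z'

end Bump

/-! ### Grid of cells and price bins. -/

section Grid

/-- The midpoints of the `M` intervals of length `1 / M` that tile `[0, 1]`. -/
def midpoint (M : ℕ) (k : Fin M) : unitInterval :=
  ⟨(2 * k + 1) / (2 * M), by
    have hk : (k : ℝ) + 1 ≤ M := by exact_mod_cast k.2
    have : (0 : ℝ) ≤ k := by positivity
    exact ⟨by positivity, div_le_one_of_le₀ (by linarith) (by positivity)⟩⟩

/-- The midpoints of the `M ^ d` cubes of side `1 / M` that tile `[0, 1] ^ d`. -/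
def gridPoint (M : ℕ) (j : Fin d → Fin M) : Covariate d := fun i => midpoint M (j i)

theorem dist_midpoint {M : ℕ} {k l : Fin M} (h : k ≠ l) :
    2 * (1 / (2 * M) : ℝ) ≤ dist (midpoint M k) (midpoint M l) := by
  have hM : (0 : ℝ) < M := by exact_mod_cast k.pos
  have h1 : (1 : ℝ) ≤ |(k : ℝ) - l| := by
    have : (1 : ℤ) ≤ |(k : ℤ) - l| :=
      Int.one_le_abs (sub_ne_zero.2 fun h' => h (Fin.ext (by exact_mod_cast h')))
    exact_mod_cast this
  rw [Subtype.dist_eq, Real.dist_eq]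
  simp only [midpoint]
  rw [show (2 * (k : ℝ) + 1) / (2 * M) - (2 * l + 1) / (2 * M) = (k - l) / M by field_simp; ring,
    abs_div, abs_of_pos hM, show 2 * (1 / (2 * M) : ℝ) = 1 / M by field_simp]
  gcongr

theorem dist_gridPoint {M : ℕ} {j l : Fin d → Fin M} (h : j ≠ l) :
    2 * (1 / (2 * M) : ℝ) ≤ dist (gridPoint M j) (gridPoint M l) := by
  obtain ⟨i, hi⟩ := Function.ne_iff.1 h
  exact (dist_midpoint hi).trans (dist_le_pi_dist (gridPoint M j) (gridPoint M l) i)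

theorem disjoint_ball_of_le_dist {α : Type*} [PseudoMetricSpace α] {a b : α} {r : ℝ}
    (h : 2 * r ≤ dist a b) : Disjoint (Metric.ball a r) (Metric.ball b r) :=
  Metric.ball_disjoint_ball (by linarith)

theorem pairwise_disjoint_ball_midpoint (M : ℕ) : Pairwise fun k l : Fin M =>
    Disjoint (Metric.ball (midpoint M k) (1 / (2 * M))) (Metric.ball (midpoint M l) (1 / (2 * M))) :=
  fun _ _ h => disjoint_ball_of_le_dist (dist_midpoint h)

end Grid

/-! ### Counting visits. -/

/-- The expected number of the first `n` rounds whose covariate lies in `S` and whose price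
lies in `P`. -/
def visits (π : Policy d) (I : Problem d) (S : Set (Covariate d)) (P : Set Price) (n : ℕ) : ℝ :=
  expTotal π I (fun o => (S ×ˢ P).indicator (1 : Covariate d × Price → ℝ) (o.1, o.2.1)) n

theorem abs_indicator_one_le {α : Type*} (s : Set α) (a : α) :
    |s.indicator (1 : α → ℝ) a| ≤ 1 := by
  by_cases h : a ∈ s <;> simp [h]

theorem indicator_prod_one_le {α β : Type*} (s : Set α) (t : Set β) (z : α × β) :
    (s ×ˢ t).indicator (1 : α × β → ℝ) z ≤ s.indicator 1 z.1 := by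
  by_cases h : z.1 ∈ s <;> by_cases h' : z.2 ∈ t <;> simp [Set.indicator, h, h']

theorem measurable_indicator_obs {S : Set (Covariate d)} {P : Set Price} (hS : MeasurableSet S)
    (hP : MeasurableSet P) : Measurable fun o : Obs d =>
      (S ×ˢ P).indicator (1 : Covariate d × Price → ℝ) (o.1, o.2.1) :=
  (measurable_one.indicator (hS.prod hP)).comp (by fun_prop)

theorem expTotal_indicator_covariate (π : Policy d) {f : Covariate d × Price → unitInterval}
    (hf : Measurable f) {S : Set (Covariate d)} (hS : MeasurableSet S) (n : ℕ) :
    expTotal π (uniformProblem f hf) (fun o => S.indicator (1 : Covariate d → ℝ) o.1) n =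
      n * (volume : Measure (Covariate d)).real S := by
  rw [expTotal_covariate π _ (measurable_one.indicator hS) (abs_indicator_one_le S)]
  congr 1
  exact integral_indicator_one hS

theorem sum_visits_le (π : Policy d) {f : Covariate d × Price → unitInterval} (hf : Measurable f)
    {S : Set (Covariate d)} (hS : MeasurableSet S) {κ : Type*} [Fintype κ] {P : κ → Set Price}
    (hP : ∀ k, MeasurableSet (P k)) (hd : Pairwise fun k l => Disjoint (P k) (P l)) (n : ℕ) :
    ∑ k, visits π (uniformProblem f hf) S (P k) n ≤
      n * (volume : Measure (Covariate d)).real S := by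
  have hm : ∀ k, Measurable fun o : Obs d =>
      (S ×ˢ P k).indicator (1 : Covariate d × Price → ℝ) (o.1, o.2.1) := fun k =>
    measurable_indicator_obs hS (hP k)
  have hle : ∀ o : Obs d, ∑ k, (S ×ˢ P k).indicator (1 : Covariate d × Price → ℝ) (o.1, o.2.1) ≤
      S.indicator (1 : Covariate d → ℝ) o.1 := by
    intro o
    by_cases h : o.1 ∈ S
    · rw [Set.indicator_of_mem h]
      refine le_trans (le_of_eq (Finset.sum_congr rfl fun k _ => ?_)) (sum_indicator_le_one hd o.2.1)
      by_cases h' : o.2.1 ∈ P k <;> simp [h, h']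
    · simp [Set.indicator, h]
  have h0 : ∀ o : Obs d,
      0 ≤ ∑ k, (S ×ˢ P k).indicator (1 : Covariate d × Price → ℝ) (o.1, o.2.1) := fun o =>
    Finset.sum_nonneg fun k _ => Set.indicator_nonneg (by simp) _
  unfold visits
  rw [← expTotal_sum π _ Finset.univ hm (fun k o => abs_indicator_one_le _ _) n,
    ← expTotal_indicator_covariate π hf hS n]
  refine expTotal_mono π _ (Finset.measurable_sum _ fun k _ => hm k) (C := 1) (fun o => ?_)
    ((measurable_one.indicator hS).comp measurable_fst) (D := 1)
    (fun o => abs_indicator_one_le _ _) hle n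
  rw [abs_of_nonneg (h0 o)]
  exact (hle o).trans ((le_abs_self _).trans (abs_indicator_one_le S o.1))

/-! ### The hard family of problems. -/

/-- The peaks of the reward function in which cell `j` favours price `σ j`. -/
def peak (M : ℕ) (σ : (Fin d → Fin M) → Fin M) (j : Fin d → Fin M) : Covariate d × Price :=
  (gridPoint M j, midpoint M (σ j))

/-- The reward function with peaks over the cells in `T`. -/
def gridReward (L : ℝ) (M : ℕ) (T : Finset (Fin d → Fin M)) (σ : (Fin d → Fin M) → Fin M) :
    Covariate d × Price → unitInterval :=
  bumpReward L (1 / (2 * M)) T (peak M σ)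

/-- The central part of cell `j`. -/
def core (M : ℕ) (j : Fin d → Fin M) : Set (Covariate d) :=
  Metric.closedBall (gridPoint M j) (1 / (2 * M) / 2)

/-- The prices close to the `k`th midpoint. -/
def priceBin (M : ℕ) (k : Fin M) : Set Price := Metric.ball (midpoint M k) (1 / (2 * M))

theorem measurableSet_core (M : ℕ) (j : Fin d → Fin M) : MeasurableSet (core M j) :=
  Metric.isClosed_closedBall.measurableSet

theorem measurableSet_priceBin (M : ℕ) (k : Fin M) : MeasurableSet (priceBin M k) :=
  Metric.isOpen_ball.measurableSet

section

variable {L : ℝ} {M : ℕ} (hL : 0 < L) (hL1 : L ≤ 1) (hM : 4 ≤ M)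

theorem half_width_bounds (hM : 4 ≤ M) : (0 : ℝ) < 1 / (2 * M) ∧ (1 / (2 * M) : ℝ) ≤ 1 / 4 := by
  have : (4 : ℝ) ≤ M := by exact_mod_cast hM
  exact ⟨by positivity, one_div_le_one_div_of_le (by norm_num) (by linarith)⟩

include hL hL1 hM

theorem measurable_gridReward (T : Finset (Fin d → Fin M)) (σ : (Fin d → Fin M) → Fin M) :
    Measurable (gridReward L M T σ) :=
  (continuous_bumpReward hL.le hL1 (half_width_bounds hM).1.le (half_width_bounds hM).2
    T _).measurable

theorem midRange_gridReward (T : Finset (Fin d → Fin M)) (σ : (Fin d → Fin M) → Fin M) :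
    MidRange (gridReward L M T σ) := fun z =>
  have h := bumpReward_mem hL.le hL1 (half_width_bounds hM).1.le (half_width_bounds hM).2
    T (peak M σ) z
  ⟨h.1, h.2.2⟩

/-- Removing the peak over one cell changes the reward function only near that peak. -/
theorem gridReward_sub_sq_le (σ : (Fin d → Fin M) → Fin M) (j : Fin d → Fin M) (k : Fin M)
    (z : Covariate d × Price) :
    ((gridReward L M Finset.univ (Function.update σ j k) z : ℝ) -
        gridReward L M (Finset.univ.erase j) σ z) ^ 2 ≤
      (L * (1 / (2 * M))) ^ 2 * (Metric.closedBall (gridPoint M j) (1 / (2 * M)) ×ˢ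
        priceBin M k).indicator 1 z := by
  obtain ⟨hw, hw4⟩ := half_width_bounds hM
  have hab : ∀ i, i ≠ j → peak M (Function.update σ j k) i = peak M σ i := fun i hi => by
    simp [peak, hi]
  by_cases hz : (1 / (2 * M) : ℝ) ≤ dist z (peak M (Function.update σ j k) j)
  · have : bumpReward L (1 / (2 * M)) (Finset.univ.erase j) (peak M σ) z =
        bumpReward L (1 / (2 * M)) Finset.univ (peak M (Function.update σ j k)) z := by
      rw [bumpReward, bump_erase_eq hab hz, bumpReward]
    rw [gridReward, gridReward, this, sub_self, zero_pow two_ne_zero]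
    exact mul_nonneg (sq_nonneg _) (Set.indicator_nonneg (by simp) _)
  · rw [not_le, Prod.dist_eq, max_lt_iff] at hz
    have hmem : z ∈ Metric.closedBall (gridPoint M j) (1 / (2 * M) : ℝ) ×ˢ priceBin M k :=
      ⟨Metric.mem_closedBall.2 hz.1.le, by simpa [peak, priceBin] using hz.2⟩
    rw [Set.indicator_of_mem hmem, Pi.one_apply, mul_one, sq_le_sq,
      abs_of_nonneg (by positivity : 0 ≤ L * (1 / (2 * M) : ℝ)), abs_le]
    have h1 := bumpReward_mem hL.le hL1 hw.le hw4 Finset.univ (peak M (Function.update σ j k)) z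
    have h2 := bumpReward_mem hL.le hL1 hw.le hw4 (Finset.univ.erase j) (peak M σ) z
    unfold gridReward
    constructor <;> linarith

/-- The loss in one round is large when the covariate is in the core of a cell and the price is
not close to the favoured price. -/
theorem le_fStar_sub (σ : (Fin d → Fin M) → Fin M) (x : Covariate d) (p : Price) :
    L * (1 / (2 * M)) / 2 * ∑ j, ((core M j).indicator 1 x -
        (core M j ×ˢ priceBin M (σ j)).indicator 1 (x, p)) ≤
      (uniformProblem _ (measurable_gridReward hL hL1 hM Finset.univ σ)).fStar x -
        gridReward L M Finset.univ σ (x, p) := by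
  obtain ⟨hw, hw4⟩ := half_width_bounds hM
  set I := uniformProblem _ (measurable_gridReward hL hL1 hM Finset.univ σ) with hI
  have hstar : ∀ q, (gridReward L M Finset.univ σ (x, q) : ℝ) ≤ I.fStar x := fun q =>
    le_ciSup (f := fun q => (I.f (x, q) : ℝ)) ⟨1, by rintro _ ⟨q, rfl⟩; exact (I.f (x, q)).2.2⟩ q
  by_cases hx : ∃ j, x ∈ core M j
  · obtain ⟨j, hj⟩ := hx
    -- With `w = 1/(2M)`, centres are `2w` apart and the core has radius `w/2`, so `x` is outside
    -- every other cone and every other core.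
    have hfar : ∀ i, i ≠ j → 1 / (2 * M : ℝ) ≤ dist x (gridPoint M i) := fun i hi => by
      have h1 := dist_gridPoint hi
      have h2 := dist_triangle_left (gridPoint M i) (gridPoint M j) x
      have h3 := Metric.mem_closedBall.1 hj
      linarith
    have hnot : ∀ i, i ≠ j → x ∉ core M i := fun i hi hxi => by
      have h1 := hfar i hi
      have h2 := Metric.mem_closedBall.1 hxi
      linarith
    rw [Finset.sum_eq_single j (fun i _ hi => by simp [Set.indicator, hnot i hi]) (by simp)]
    by_cases hp : p ∈ priceBin M (σ j)
    · simp only [Set.indicator, hj, hp, Set.mem_prod, and_self, if_true, Pi.one_apply, sub_self,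
        mul_zero]
      linarith [hstar p]
    · simp only [Set.indicator, hj, hp, Set.mem_prod, and_false, if_true, if_false, Pi.one_apply,
        sub_zero, mul_one]
      have h1 : (gridReward L M Finset.univ σ (x, p) : ℝ) = 1 / 2 := by
        rw [gridReward, coe_bumpReward hL.le hL1 hw.le hw4, bump_eq_zero]
        · simp
        · intro i _
          rw [Prod.dist_eq]
          by_cases hi : i = j
          · subst hi
            exact le_max_of_le_right (not_lt.1 hp)
          · exact le_max_of_le_left (hfar i hi)
      have h2 : 1 / 2 + L * (1 / (2 * M) / 2) ≤
          (gridReward L M Finset.univ σ (x, midpoint M (σ j)) : ℝ) := by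
        rw [gridReward, coe_bumpReward hL.le hL1 hw.le hw4]
        have h3 := le_bump (1 / (2 * M)) (peak M σ) (x, midpoint M (σ j)) (Finset.mem_univ j)
        have h4 : dist (x, midpoint M (σ j)) (peak M σ j) ≤ 1 / (2 * M) / 2 := by
          rw [Prod.dist_eq]
          exact max_le (Metric.mem_closedBall.1 hj) (by simp only [peak, dist_self]; positivity)
        have := mul_le_mul_of_nonneg_left (a := L) (by linarith : 1 / (2 * M) / 2 ≤
          (bump (1 / (2 * M)) Finset.univ (peak M σ) (x, midpoint M (σ j)) : ℝ)) hL.le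
        linarith
      have h3 := hstar (midpoint M (σ j))
      linarith
  · push Not at hx
    rw [Finset.sum_eq_zero fun j _ => by simp [Set.indicator, hx j]]
    linarith [hstar p]

theorem measurable_loss (σ : (Fin d → Fin M) → Fin M) : Measurable fun o : Obs d =>
    (uniformProblem _ (measurable_gridReward hL hL1 hM Finset.univ σ)).fStar o.1 -
      (gridReward L M Finset.univ σ (o.1, o.2.1) : ℝ) := by
  obtain ⟨hw, hw4⟩ := half_width_bounds hM
  have hc : Continuous (gridReward L M Finset.univ σ) :=
    continuous_bumpReward hL.le hL1 hw.le hw4 _ _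
  -- The supremum runs over uncountably many prices; semicontinuity supplies its measurability.
  have hlsc : LowerSemicontinuous
      (uniformProblem _ (measurable_gridReward hL hL1 hM Finset.univ σ)).fStar :=
    lowerSemicontinuous_ciSup
      (fun x => ⟨1, by rintro _ ⟨q, rfl⟩; exact (gridReward L M Finset.univ σ (x, q)).2.2⟩)
      fun p => Continuous.lowerSemicontinuous
        (f := fun x => (gridReward L M Finset.univ σ (x, p) : ℝ))
        (continuous_subtype_val.comp (hc.comp (Continuous.prodMk_left p)))
  exact (hlsc.measurable.comp measurable_fst).sub
    (measurable_subtype_coe.comp (hc.measurable.comp (by fun_prop)))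

theorem le_regret (π : Policy d) (σ : (Fin d → Fin M) → Fin M) (n : ℕ) :
    L * (1 / (2 * M)) / 2 * ∑ j, (n * (volume : Measure (Covariate d)).real (core M j) -
      visits π (uniformProblem _ (measurable_gridReward hL hL1 hM Finset.univ σ))
        (core M j) (priceBin M (σ j)) n) ≤
      regret π (uniformProblem _ (measurable_gridReward hL hL1 hM Finset.univ σ)) n := by
  obtain ⟨hw, hw4⟩ := half_width_bounds hM
  set I := uniformProblem _ (measurable_gridReward hL hL1 hM Finset.univ σ) with hI
  have hm1 : ∀ j : Fin d → Fin M, Measurable fun o : Obs d =>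
      (core M j).indicator (1 : Covariate d → ℝ) o.1 := fun j =>
    (measurable_one.indicator (measurableSet_core M j)).comp measurable_fst
  have hm2 : ∀ j : Fin d → Fin M, Measurable fun o : Obs d => (core M j ×ˢ
      priceBin M (σ j)).indicator (1 : Covariate d × Price → ℝ) (o.1, o.2.1) := fun j =>
    measurable_indicator_obs (measurableSet_core M j) (measurableSet_priceBin M _)
  have hb : ∀ (j : Fin d → Fin M) (o : Obs d), |(core M j).indicator (1 : Covariate d → ℝ) o.1 -
      (core M j ×ˢ priceBin M (σ j)).indicator (1 : Covariate d × Price → ℝ) (o.1, o.2.1)| ≤ 2 :=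
    fun j o => (abs_sub _ _).trans (by
      linarith [abs_indicator_one_le (core M j) o.1,
        abs_indicator_one_le (core M j ×ˢ priceBin M (σ j)) (o.1, o.2.1)])
  have hb1 : ∀ o : Obs d, |I.fStar o.1 - (I.f (o.1, o.2.1) : ℝ)| ≤ 1 := fun o => by
    have h1 : I.fStar o.1 ≤ 1 := ciSup_le fun p => (I.f (o.1, p)).2.2
    have h2 : (I.f (o.1, o.2.1) : ℝ) ≤ I.fStar o.1 :=
      le_ciSup (f := fun q => (I.f (o.1, q) : ℝ))
        ⟨1, by rintro _ ⟨q, rfl⟩; exact (I.f (o.1, q)).2.2⟩ o.2.1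
    have h3 := (I.f (o.1, o.2.1)).2.1
    rw [abs_of_nonneg (by linarith)]
    linarith
  have hsum : ∑ j, (n * (volume : Measure (Covariate d)).real (core M j) -
      visits π I (core M j) (priceBin M (σ j)) n) =
      expTotal π I (fun o => ∑ j, ((core M j).indicator 1 o.1 -
        (core M j ×ˢ priceBin M (σ j)).indicator 1 (o.1, o.2.1))) n := by
    rw [expTotal_sum π I Finset.univ (F := fun j o => (core M j).indicator 1 o.1 -
        (core M j ×ˢ priceBin M (σ j)).indicator 1 (o.1, o.2.1))
      (fun j => (hm1 j).sub (hm2 j)) hb n]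
    refine Finset.sum_congr rfl fun j _ => ?_
    rw [expTotal_sub π I (hm1 j) (fun o => abs_indicator_one_le _ _) (hm2 j)
      (fun o => abs_indicator_one_le _ _), expTotal_indicator_covariate π _
      (measurableSet_core M j) n]
    rfl
  rw [hsum, ← expTotal_const_mul,
    regret_eq_expTotal π I (measurable_loss hL hL1 hM σ) hb1 n]
  refine expTotal_mono π I ((Finset.measurable_sum _ fun j _ => (hm1 j).sub (hm2 j)).const_mul _)
    (C := L * (1 / (2 * M)) / 2 * ∑ _j : Fin d → Fin M, 2) (fun o => ?_)
    (measurable_loss hL hL1 hM σ) hb1 (fun o => le_fStar_sub hL hL1 hM σ o.1 o.2.1) n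
  rw [abs_mul, abs_of_nonneg (by positivity)]
  exact mul_le_mul_of_nonneg_left ((Finset.abs_sum_le_sum_abs _ _).trans
    (Finset.sum_le_sum fun j _ => hb j o)) (by positivity)

/-- Over all favoured prices of cell `j`, the favoured price is on average chosen in at most half
of the rounds in which the covariate is in the core of the cell. -/
theorem sum_visits_update_le (π : Policy d) (σ : (Fin d → Fin M) → Fin M) (j : Fin d → Fin M)
    {n : ℕ} (hn : 256 * (n : ℝ) ≤ (M : ℝ) ^ (d + 3)) :
    ∑ k, visits π (uniformProblem _ (measurable_gridReward hL hL1 hM Finset.univ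
        (Function.update σ j k))) (core M j) (priceBin M k) n ≤
      M * (n * (volume : Measure (Covariate d)).real (core M j) / 2) := by
  obtain ⟨hw, hw4⟩ := half_width_bounds hM
  set I₀ := uniformProblem _ (measurable_gridReward hL hL1 hM (Finset.univ.erase j) σ) with hI₀
  set w : ℝ := 1 / (2 * M) with hw_def
  set q := (volume : Measure (Covariate d)).real (core M j) with hq
  have hq0 : 0 ≤ q := measureReal_nonneg
  set B := Metric.closedBall (gridPoint M j) w with hB
  have hBm : MeasurableSet B := Metric.isClosed_closedBall.measurableSet
  have hM4 : (4 : ℝ) ≤ M := by exact_mod_cast hM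
  have hstep : ∀ k, visits π (uniformProblem _ (measurable_gridReward hL hL1 hM Finset.univ
        (Function.update σ j k))) (core M j) (priceBin M k) n ≤
      visits π I₀ (core M j) (priceBin M k) n +
        n * (q * (64 * ((L * w) ^ 2 * visits π I₀ B (priceBin M k) n) + 1 / 8)) := by
    intro k
    have h0 := midRange_gridReward hL hL1 hM (Finset.univ.erase j) σ
    have h1 := midRange_gridReward hL hL1 hM Finset.univ (Function.update σ j k)
    have hm0 := measurable_gridReward hL hL1 hM (Finset.univ.erase j) σ
    have hm1 := measurable_gridReward hL hL1 hM Finset.univ (Function.update σ j k)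
    have hch := expTotal_change_le π hm0 hm1 h0 h1
      (F := (core M j ×ˢ priceBin M k).indicator 1)
      (measurable_one.indicator ((measurableSet_core M j).prod (measurableSet_priceBin M k)))
      (g := (core M j).indicator 1) (measurable_one.indicator (measurableSet_core M j))
      (fun z => Set.indicator_nonneg (by simp) _) (indicator_prod_one_le _ _)
      (fun x => (le_abs_self _).trans (abs_indicator_one_le _ x)) n
    rw [integral_indicator_one (measurableSet_core M j)] at hch
    refine hch.trans ?_
    have hsq : expTotal π I₀ (fun o =>
        ((gridReward L M Finset.univ (Function.update σ j k) (o.1, o.2.1) : ℝ) -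
          gridReward L M (Finset.univ.erase j) σ (o.1, o.2.1)) ^ 2) n ≤
        (L * w) ^ 2 * visits π I₀ B (priceBin M k) n := by
      rw [visits, ← expTotal_const_mul]
      have hb : ∀ o : Obs d, |(L * w) ^ 2 * (B ×ˢ priceBin M k).indicator
          (1 : Covariate d × Price → ℝ) (o.1, o.2.1)| ≤ (L * w) ^ 2 := fun o => by
        rw [abs_mul, abs_of_nonneg (by positivity)]
        exact mul_le_of_le_one_right (by positivity) (abs_indicator_one_le _ _)
      refine expTotal_mono π I₀ (((measurable_subtype_coe.comp (hm1.comp (by fun_prop))).sub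
        (measurable_subtype_coe.comp (hm0.comp (by fun_prop)))).pow_const 2) (C := (L * w) ^ 2) (fun o => ?_)
        ((measurable_indicator_obs hBm (measurableSet_priceBin M k)).const_mul _) hb
        (fun o => gridReward_sub_sq_le hL hL1 hM σ j k _) n
      rw [abs_of_nonneg (sq_nonneg _)]
      exact (gridReward_sub_sq_le hL hL1 hM σ j k _).trans ((le_abs_self _).trans (hb o))
    unfold visits at hsq ⊢
    gcongr
  have hcore := sum_visits_le π (measurable_gridReward hL hL1 hM (Finset.univ.erase j) σ)
    (measurableSet_core M j) (measurableSet_priceBin M) (pairwise_disjoint_ball_midpoint M) n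
  have hball := sum_visits_le π (measurable_gridReward hL hL1 hM (Finset.univ.erase j) σ)
    hBm (measurableSet_priceBin M) (pairwise_disjoint_ball_midpoint M) n
  have hvol : (volume : Measure (Covariate d)).real B ≤ (2 * w) ^ d :=
    (volume_closedBall_covariate (gridPoint M j) hw.le (by linarith)).2
  refine (Finset.sum_le_sum fun k _ => hstep k).trans ?_
  rw [Finset.sum_add_distrib, ← Finset.mul_sum, ← Finset.mul_sum, Finset.sum_add_distrib,
    ← Finset.mul_sum, ← Finset.mul_sum]
  simp only [Finset.sum_const, Finset.card_univ, Fintype.card_fin, nsmul_eq_mul]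
  -- The bins are disjoint, so their visits total at most `n (2w)^d = n M^(-d)`. The left side is
  -- then at most `16 n / M^(d+2)`, which is where `256 n ≤ M^(d+3)` is needed.
  have hkl : 64 * ((L * w) ^ 2 * ∑ k, visits π I₀ B (priceBin M k) n) ≤ M / 16 := by
    have h1 : (L * w) ^ 2 ≤ w ^ 2 := by
      gcongr
      exact mul_le_of_le_one_left hw.le hL1
    have h2 : ∑ k, visits π I₀ B (priceBin M k) n ≤ n * (2 * w) ^ d :=
      hball.trans (mul_le_mul_of_nonneg_left hvol (by positivity))
    have h3 : 0 ≤ ∑ k, visits π I₀ B (priceBin M k) n := Finset.sum_nonneg fun k _ =>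
      expTotal_nonneg π I₀ (fun o => Set.indicator_nonneg (by simp) _) n
    calc _ ≤ 64 * (w ^ 2 * (n * (2 * w) ^ d)) := by gcongr
      _ = 16 * n / (M : ℝ) ^ (d + 2) := by
        have : 2 * w = 1 / M := by rw [hw_def]; field_simp
        rw [this, hw_def, one_div_pow (M : ℝ) d]
        field_simp
        ring
      _ ≤ M / 16 := by
        rw [div_le_div_iff₀ (by positivity) (by norm_num)]
        have : (M : ℝ) * M ^ (d + 2) = M ^ (d + 3) := by ring
        linarith
  calc _ ≤ n * q + n * (q * (M / 16 + M * (1 / 8))) := by gcongr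
    _ = n * q * (1 + M * (3 / 16)) := by ring
    _ ≤ n * q * (M / 2) := by
      gcongr
      linarith
    _ = _ := by ring

theorem exists_le_regret (π : Policy d) {n : ℕ} (hn : 256 * (n : ℝ) ≤ (M : ℝ) ^ (d + 3)) :
    ∃ σ : (Fin d → Fin M) → Fin M, L * (1 / (2 * M)) / 4 * (n * (1 / 4) ^ d) ≤
      regret π (uniformProblem _ (measurable_gridReward hL hL1 hM Finset.univ σ)) n := by
  obtain ⟨hw, hw4⟩ := half_width_bounds hM
  have hM4 : (4 : ℝ) ≤ M := by exact_mod_cast hM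
  set q : (Fin d → Fin M) → ℝ := fun j => (volume : Measure (Covariate d)).real (core M j) with hq
  set V : ((Fin d → Fin M) → Fin M) → (Fin d → Fin M) → ℝ := fun σ j =>
    visits π (uniformProblem _ (measurable_gridReward hL hL1 hM Finset.univ σ))
      (core M j) (priceBin M (σ j)) n with hV
  have hVsum : ∀ j, ∑ σ, V σ j ≤ ∑ _σ : (Fin d → Fin M) → Fin M, n * q j / 2 := by
    intro j
    have h1 := sum_sum_update (fun σ => V σ j) j
    have h2 : ∑ σ : (Fin d → Fin M) → Fin M, ∑ k, V (Function.update σ j k) j ≤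
        ∑ _σ : (Fin d → Fin M) → Fin M, M * (n * q j / 2) := by
      refine Finset.sum_le_sum fun σ _ => ?_
      simp only [hV, Function.update_self]
      exact sum_visits_update_le hL hL1 hM π σ j hn
    rw [h1, ← Finset.mul_sum, Fintype.card_fin] at h2
    exact le_of_mul_le_mul_left h2 (by linarith)
  -- There are `M^d` cores, each of volume at least `(1/(4M))^d`.
  have hqsum : (1 / 4 : ℝ) ^ d ≤ ∑ j, q j := by
    calc (1 / 4 : ℝ) ^ d = ∑ _j : Fin d → Fin M, (1 / (2 * M) / 2 : ℝ) ^ d := by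
          simp only [Finset.sum_const, Finset.card_univ, Fintype.card_fun, Fintype.card_fin,
            nsmul_eq_mul, Nat.cast_pow]
          rw [← mul_pow]
          congr 1
          field_simp
          norm_num
      _ ≤ _ := Finset.sum_le_sum fun j _ =>
          (volume_closedBall_covariate (gridPoint M j) (by positivity) (by linarith)).1
  have : NeZero M := ⟨by omega⟩
  by_contra! hcon
  have hlt : ∑ σ : (Fin d → Fin M) → Fin M,
      L * (1 / (2 * M)) / 2 * ∑ j, (n * q j - V σ j) <
      ∑ _σ : (Fin d → Fin M) → Fin M, L * (1 / (2 * M)) / 4 * (n * (1 / 4) ^ d) :=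
    Finset.sum_lt_sum_of_nonempty Finset.univ_nonempty fun σ _ =>
      (le_regret hL hL1 hM π σ n).trans_lt (hcon σ)
  refine absurd hlt (not_lt.2 ?_)
  rw [← Finset.mul_sum (f := fun σ => ∑ j, (n * q j - V σ j)), Finset.sum_comm]
  have h3 : ∑ j, ∑ _σ : (Fin d → Fin M) → Fin M, n * q j / 2 ≤
      ∑ j, ∑ σ : (Fin d → Fin M) → Fin M, (n * q j - V σ j) := by
    refine Finset.sum_le_sum fun j _ => ?_
    rw [Finset.sum_sub_distrib]
    have h4 := hVsum j
    have h5 : ∑ _σ : (Fin d → Fin M) → Fin M, n * q j = 2 *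
        ∑ _σ : (Fin d → Fin M) → Fin M, n * q j / 2 := by
      rw [Finset.mul_sum]
      exact Finset.sum_congr rfl fun _ _ => by ring
    linarith
  have h6 : ∑ _σ : (Fin d → Fin M) → Fin M, L * (1 / (2 * M)) / 4 * (n * (1 / 4) ^ d) ≤
      L * (1 / (2 * M)) / 2 * ∑ j, ∑ _σ : (Fin d → Fin M) → Fin M, n * q j / 2 := by
    rw [Finset.sum_comm, Finset.mul_sum]
    refine Finset.sum_le_sum fun σ _ => ?_
    rw [← Finset.sum_div, ← Finset.mul_sum]
    have : (n : ℝ) * (1 / 4) ^ d ≤ n * ∑ j, q j := by gcongr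
    have := mul_le_mul_of_nonneg_left this (by positivity : 0 ≤ L * (1 / (2 * M)) / 4)
    linarith
  exact h6.trans (mul_le_mul_of_nonneg_left h3 (by positivity))

theorem uniformProblem_mem_problemClass {CLip cQ CQ : ℝ} (hLC : L ≤ CLip) (hcQ1 : cQ ≤ 1)
    (hCQ : 2 ^ d ≤ CQ) (σ : (Fin d → Fin M) → Fin M) :
    uniformProblem _ (measurable_gridReward hL hL1 hM Finset.univ σ) ∈
      problemClass d CLip cQ CQ := by
  refine ⟨fun z z' => ?_, ballMass_uniformProblem _ hcQ1 hCQ⟩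
  exact (abs_bumpReward_sub_le hL.le hL1 (half_width_bounds hM).1.le (half_width_bounds hM).2
    _ _ z z').trans (mul_le_mul_of_nonneg_right hLC dist_nonneg)

end

/-! ### Choice of the grid and conclusion. -/

/-- A grid size adapted to the number of rounds. -/
theorem exists_gridSize (d n : ℕ) (hd1 : 1 ≤ d) (hn : 1 ≤ n) : ∃ M : ℕ, 4 ≤ M ∧
    256 * (n : ℝ) ≤ (M : ℝ) ^ (d + 3) ∧
    (n : ℝ) ^ (((d : ℝ) + 2) / ((d : ℝ) + 3)) / 8 ≤ n / M := by
  have hn1 : (1 : ℝ) ≤ n := by exact_mod_cast hn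
  have hd : (0 : ℝ) < d + 3 := by positivity
  set s : ℝ := (n : ℝ) ^ (1 / ((d : ℝ) + 3)) with hs
  have hs1 : 1 ≤ s := Real.one_le_rpow hn1 (by positivity)
  have hspow : s ^ (d + 3) = n := by
    rw [hs, ← Real.rpow_natCast, ← Real.rpow_mul (by positivity)]
    push_cast
    rw [one_div_mul_cancel hd.ne', Real.rpow_one]
  have hceil : s ≤ ⌈s⌉₊ := Nat.le_ceil s
  have hceil' : (⌈s⌉₊ : ℝ) < s + 1 := Nat.ceil_lt_add_one (by linarith)
  have hceil1 : 1 ≤ ⌈s⌉₊ := Nat.one_le_ceil_iff.2 (by linarith)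
  -- The factor `4` absorbs the `256`, since `4^(d+3) ≥ 4^4` for `d ≥ 1`; and `4⌈s⌉ ≤ 8s` because `s
  -- ≥ 1`.
  refine ⟨4 * ⌈s⌉₊, by omega, ?_, ?_⟩
  · push_cast
    rw [mul_pow]
    have h1 : (256 : ℝ) ≤ 4 ^ (d + 3) := by
      have : (4 : ℝ) ^ 4 ≤ 4 ^ (d + 3) := pow_le_pow_right₀ (by norm_num) (by omega)
      norm_num at this ⊢
      linarith
    rw [← hspow]
    gcongr
  · have hexp : (n : ℝ) ^ (((d : ℝ) + 2) / ((d : ℝ) + 3)) = n / s := by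
      rw [hs, ← Real.rpow_one_sub' (by positivity)]
      · congr 1
        field_simp
        ring
      · rw [sub_ne_zero, ne_comm, Ne, div_eq_one_iff_eq hd.ne']
        have : (0 : ℝ) ≤ d := by positivity
        linarith
    rw [hexp, div_div]
    push_cast
    exact div_le_div_of_nonneg_left (by positivity) (by positivity) (by linarith)

end DynamicPricing

end

theorem corollary1 (d : ℕ) (hd : 1 ≤ d) (CLip cQ : ℝ) (hCLip : 0 < CLip)
    (hcQ : 0 < cQ) (hcQ1 : cQ ≤ 1) :
    ∃ c : ℝ, 0 < c ∧ ∀ CQ : ℝ, (2 : ℝ) ^ d ≤ CQ → ∀ n : ℕ, 1 ≤ n →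
      ((c * (n : ℝ) ^ (((d : ℝ) + 2) / ((d : ℝ) + 3)) : ℝ) : EReal) ≤
        ⨅ π : DynamicPricing.Policy d,
          ⨆ I ∈ DynamicPricing.problemClass d CLip cQ CQ,
            ((DynamicPricing.regret π I n : ℝ) : EReal) := by
  -- Capping the slope at `1` keeps the rewards in `[1/2, 3/4]` and inside the Lipschitz class.
  have hL : 0 < min CLip 1 := lt_min hCLip one_pos
  have hL1 : min CLip 1 ≤ 1 := min_le_right _ _
  refine ⟨min CLip 1 * (1 / 4) ^ d / 64, by positivity, fun CQ hCQ n hn => le_iInf fun π => ?_⟩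
  obtain ⟨M, hM, hMn, hnM⟩ := DynamicPricing.exists_gridSize d n hd hn
  obtain ⟨σ, hσ⟩ := DynamicPricing.exists_le_regret hL hL1 hM π hMn
  refine le_iSup₂_of_le _ (DynamicPricing.uniformProblem_mem_problemClass hL hL1 hM
    (min_le_left _ _) hcQ1 hCQ σ) (EReal.coe_le_coe_iff.2 (le_trans ?_ hσ))
  calc _ = min CLip 1 * (1 / 4) ^ d / 8 * ((n : ℝ) ^ (((d : ℝ) + 2) / ((d : ℝ) + 3)) / 8) := by
        ring
    _ ≤ min CLip 1 * (1 / 4) ^ d / 8 * (n / M) := by gcongr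
    _ = _ := by ring
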